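/- Let $K\subseteq\mathbb R^2$ be a convex body (a compact convex set with non-empty interior) and let $p\in(-1,0)$. For $x\in K$ and $v\in\mathbb R^2$ let $\varrho_K(x,v)=\sup\{\lambda\ge 0: x+\lambda v\in K\}\in[0,\infty]$ be the radial function of $K$ at $x$ in the direction $v$, and put $$\|v\|_{R_pK}=\left(\frac1{\operatorname{vol}(K)}\int_K\varrho_K(x,v)^p\,dx\right)^{-1/p},$$ with the conventions $\infty^p=0$ and $0^p=\infty$ (so that $\|0\|_{R_pK}=0$). Then the radial mean body $$R_pK=\{v\in\mathbb R^2:\|v\|_{R_pK}\le 1\}$$ is convex. Moreover, $\|v\|_{R_pK}<\infty$ for every $v\in\mathbb R^2$, and the function $v\mapsto\|v\|_{R_pK}$ is convex on $\mathbb R^2$. -/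

import Mathlib

open scoped NNReal ENNReal

/-- The radial function of `K` with respect to the point `x` in the direction `v`: the supremum of
all `t ≥ 0` with `x + t v ∈ K`. For compact `K`, `x ∈ K` and `v ≠ 0` it is finite and attained;
for `x ∈ K` and `v = 0` it is `∞`. -/
noncomputable def radialFun {n : ℕ} (K : Set (EuclideanSpace ℝ (Fin n)))
    (x v : EuclideanSpace ℝ (Fin n)) : ℝ≥0∞ :=
  ⨆ (t : ℝ≥0) (_ : x + (t : ℝ) • v ∈ K), (t : ℝ≥0∞)

/-- The gauge `‖v‖_{R_p K} = ((1 / vol K) ∫_K ρ_K(x, v) ^ p dx) ^ (-1 / p)` for `p > -1`, `p ≠ 0`,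
with values in `[0, ∞]`. The conventions `∞ ^ p = 0` and `0 ^ p = ∞` for `p < 0` make it vanish at
`v = 0`. -/
noncomputable def radialMeanNorm {n : ℕ} (p : ℝ) (K : Set (EuclideanSpace ℝ (Fin n)))
    (v : EuclideanSpace ℝ (Fin n)) : ℝ≥0∞ :=
  ((MeasureTheory.volume K)⁻¹ * ∫⁻ x in K, radialFun K x v ^ p) ^ (-1 / p)

/-- The radial mean body `R_p K`, the unit level set of the gauge. -/
def radialMeanBody {n : ℕ} (p : ℝ) (K : Set (EuclideanSpace ℝ (Fin n))) :
    Set (EuclideanSpace ℝ (Fin n)) :=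
  {v | radialMeanNorm p K v ≤ 1}

/-!
Write `p = -s` with `0 < s < 1`. By the layer cake formula (`setLIntegral_radialFun_rpow`),
`∫_K ρ_K(x, v) ^ p dx` is the energy `G(v) = ∫ s r ^ (-s - 1) d(r v) dr` over `r > 0`, where `d(w)`
is the area of the part of `K` that leaves `K` under translation by `w`. Since `d` is subadditive and
`d(w) = O(‖w‖)`, the function `G` is finite and continuous, and it is homogeneous of degree `s`. The
gauge is `F = (G / vol K) ^ (1 / s)`, a finite continuous function, positively homogeneous of
degree `1`.

A positively homogeneous function on a plane is linear along rays, so its convexity near a point `z`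
needs to be tested in one direction `τ` transversal to `z` only, and this direction may depend
on `z`. If for each `z ≠ 0` there is such a `τ` with
`F(z + tτ) + F(z - tτ) ≥ 2 F(z) - o(t ^ 2)`, then `F` is convex (`convexOn_of_second_difference`):
otherwise the difference of `F` and a linear function, less a small multiple of a strictly concave
function of the direction, would have an interior maximum violating the inequality.

The direction `τ` is that of two parallel supporting lines of `K` at the ends of a longest chord
parallel to `z` (`exists_strip`). In coordinates along `z` and `τ` the chord is `[0, D] × {0}` and `K`
lies in `[0, D] × ℝ`, so each section of `K` in direction `τ` is an interval that contains `0`. Two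
such intervals always meet, and the length of the overlap of one with a translate of the other is a
concave function of the translation as long as they still meet. Integrating over the sections
gives, for translations of length `r` along the chord, that the area of the overlap of `K` with its
translates has nonpositive second difference in direction `τ`. If `K` lies on one
side of the chord, the inequality persists when the translated sections do not meet. Otherwise they
can fail to meet only if `r` is within `O(t)` of `D`, and only in a part of `K` of width `O(t)` there;
this adds `O(t ^ 2)` for `r` in a range of length `O(t)`
(`exists_plane_overlap_second_difference`). Hence `G` has second differences bounded below by
`-O(t ^ 3)` (`exists_shiftEnergy_second_difference`), and the tangent inequality for `x ^ (1 / s)`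
carries this over to `F`.
-/

open MeasureTheory Set

/-! ### The layer cake formula for the power mean of the radial function -/

/-- The part of the volume of `K` that leaves `K` under translation by `w`, that is
`vol K - vol (K ∩ (K - w))`. -/
noncomputable def shiftLoss {n : ℕ} (K : Set (EuclideanSpace ℝ (Fin n)))
    (w : EuclideanSpace ℝ (Fin n)) : ℝ≥0∞ :=
  volume {x | x ∈ K ∧ x + w ∉ K}

/-- The power mean `∫_K ρ_K(x, v) ^ (-s) dx`, in the form which the layer cake formula gives it. -/
noncomputable def shiftEnergy {n : ℕ} (s : ℝ) (K : Set (EuclideanSpace ℝ (Fin n)))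
    (v : EuclideanSpace ℝ (Fin n)) : ℝ≥0∞ :=
  ∫⁻ r in Ioi (0 : ℝ), ENNReal.ofReal (s * r ^ (-s - 1)) * shiftLoss K (r • v)

lemma lintegral_Ioi_mul_rpow_neg {s c : ℝ} (hs : 0 < s) (hc : 0 < c) :
    ∫⁻ r in Ioi c, ENNReal.ofReal (s * r ^ (-s - 1)) = ENNReal.ofReal (c ^ (-s)) := by
  have hint : IntegrableOn (fun r : ℝ => s * r ^ (-s - 1)) (Ioi c) :=
    (integrableOn_Ioi_rpow_of_lt (by linarith) hc).const_mul s
  rw [← ofReal_integral_eq_lintegral_ofReal hint]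
  · rw [integral_const_mul, integral_Ioi_rpow_of_lt (by linarith) hc]
    congr 1
    have : -s - 1 + 1 = -s := by ring
    rw [this]; field_simp
  · filter_upwards [ae_restrict_mem measurableSet_Ioi] with r hr
    have : 0 < r := hc.trans hr
    simp only [Pi.zero_apply]; positivity

lemma lintegral_Ioi_zero_mul_rpow_neg {s : ℝ} (hs : 0 < s) :
    ∫⁻ r in Ioi (0 : ℝ), ENNReal.ofReal (s * r ^ (-s - 1)) = ∞ := by
  refine ENNReal.eq_top_of_forall_nnreal_le fun b => ?_
  have hc : (0 : ℝ) < ((b : ℝ) + 1) ^ (-s⁻¹) := by positivity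
  calc (b : ℝ≥0∞) ≤ ENNReal.ofReal ((((b : ℝ) + 1) ^ (-s⁻¹)) ^ (-s)) := by
        rw [← Real.rpow_mul (by positivity)]
        have : -s⁻¹ * -s = 1 := by field_simp
        rw [this, Real.rpow_one, ← ENNReal.ofReal_coe_nnreal]
        exact ENNReal.ofReal_le_ofReal (by linarith)
    _ = _ := (lintegral_Ioi_mul_rpow_neg hs hc).symm
    _ ≤ _ := lintegral_mono_set (Ioi_subset_Ioi hc.le)

lemma lintegral_Ioi_toReal_mul_rpow_neg {s : ℝ} (hs : 0 < s) {ρ : ℝ≥0∞} (hρ : ρ ≠ ∞) :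
    ∫⁻ r in Ioi ρ.toReal, ENNReal.ofReal (s * r ^ (-s - 1)) = ρ ^ (-s) := by
  rcases eq_or_ne ρ 0 with rfl | h0
  · rw [ENNReal.toReal_zero, lintegral_Ioi_zero_mul_rpow_neg hs,
      ENNReal.zero_rpow_of_neg (by linarith)]
  · have hpos := ENNReal.toReal_pos h0 hρ
    rw [lintegral_Ioi_mul_rpow_neg hs hpos, ← ENNReal.ofReal_rpow_of_pos hpos,
      ENNReal.ofReal_toReal hρ]

lemma le_radialFun {n : ℕ} {K : Set (EuclideanSpace ℝ (Fin n))} {x v : EuclideanSpace ℝ (Fin n)}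
    {r : ℝ} (hr : 0 ≤ r) (h : x + r • v ∈ K) : ENNReal.ofReal r ≤ radialFun K x v :=
  le_iSup₂_of_le (f := fun (t : ℝ≥0) (_ : x + (t : ℝ) • v ∈ K) => (t : ℝ≥0∞)) r.toNNReal
    (by rwa [Real.coe_toNNReal _ hr]) le_rfl

lemma radialFun_le {n : ℕ} {K : Set (EuclideanSpace ℝ (Fin n))} (hK : Convex ℝ K)
    {x v : EuclideanSpace ℝ (Fin n)} (hx : x ∈ K) {r : ℝ} (hr : 0 < r) (h : x + r • v ∉ K) :
    radialFun K x v ≤ ENNReal.ofReal r := by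
  refine iSup₂_le fun t ht => ?_
  by_contra! hlt
  rw [← ENNReal.ofReal_coe_nnreal] at hlt
  have hrt : r < t := (ENNReal.ofReal_lt_ofReal_iff_of_nonneg hr.le).1 hlt
  have ht0 : (0 : ℝ) < t := hr.trans hrt
  refine h ?_
  have := hK.add_smul_mem hx ht (t := r / t) ⟨by positivity, by rw [div_le_one ht0]; exact hrt.le⟩
  rwa [smul_smul, div_mul_cancel₀ _ ht0.ne'] at this

lemma lintegral_exit_eq_radialFun_rpow {n : ℕ} {K : Set (EuclideanSpace ℝ (Fin n))}
    (hK : Convex ℝ K) {s : ℝ} (hs : 0 < s) {x v : EuclideanSpace ℝ (Fin n)} (hx : x ∈ K) :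
    ∫⁻ r in Ioi (0 : ℝ), {r : ℝ | x + r • v ∉ K}.indicator
      (fun r => ENNReal.ofReal (s * r ^ (-s - 1))) r = radialFun K x v ^ (-s) := by
  by_cases hρ : radialFun K x v = ∞
  · rw [hρ, ENNReal.top_rpow_of_neg (by linarith)]
    rw [setLIntegral_congr_fun (g := fun _ => 0) measurableSet_Ioi]
    · simp
    · intro r hr
      refine indicator_of_notMem (fun h => ?_) _
      have := radialFun_le hK hx hr h
      rw [hρ] at this
      exact absurd this (by simp)
  · rw [← lintegral_Ioi_toReal_mul_rpow_neg hs hρ,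
      ← lintegral_indicator measurableSet_Ioi, ← lintegral_indicator measurableSet_Ioi]
    refine lintegral_congr_ae ?_
    have hne : ∀ᵐ r : ℝ, r ≠ (radialFun K x v).toReal := by
      simp [ae_iff, measure_singleton]
    filter_upwards [hne] with r hr
    by_cases hr0 : 0 < r
    · rw [indicator_of_mem (show r ∈ Ioi (0 : ℝ) from hr0)]
      by_cases hxr : x + r • v ∈ K
      · have h1 := le_radialFun hr0.le hxr
        rw [indicator_of_notMem (by simpa using hxr), indicator_of_notMem]
        rw [ENNReal.ofReal_le_iff_le_toReal hρ] at h1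
        simpa using h1
      · have h1 := radialFun_le hK hx hr0 hxr
        rw [indicator_of_mem (by simpa using hxr), indicator_of_mem]
        have := ENNReal.toReal_mono ENNReal.ofReal_ne_top h1
        rw [ENNReal.toReal_ofReal hr0.le] at this
        exact lt_of_le_of_ne this hr.symm
    · rw [indicator_of_notMem (by simpa using hr0), indicator_of_notMem]
      have : 0 ≤ (radialFun K x v).toReal := ENNReal.toReal_nonneg
      simp only [mem_Ioi, not_lt]; linarith

lemma setLIntegral_radialFun_rpow {n : ℕ} {K : Set (EuclideanSpace ℝ (Fin n))}
    (hK : Convex ℝ K) (hKm : MeasurableSet K) {s : ℝ} (hs : 0 < s)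
    (v : EuclideanSpace ℝ (Fin n)) :
    ∫⁻ x in K, radialFun K x v ^ (-s) = shiftEnergy s K v := by
  have hU : MeasurableSet {q : EuclideanSpace ℝ (Fin n) × ℝ | q.1 + q.2 • v ∉ K} :=
    (hKm.preimage (by fun_prop : Measurable
      fun q : EuclideanSpace ℝ (Fin n) × ℝ => q.1 + q.2 • v)).compl
  have hw : Measurable fun r : ℝ => ENNReal.ofReal (s * r ^ (-s - 1)) := by fun_prop
  rw [setLIntegral_congr_fun hKm
    (fun x hx => (lintegral_exit_eq_radialFun_rpow hK hs (v := v) hx).symm)]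
  rw [lintegral_lintegral_swap]
  · refine lintegral_congr fun r => ?_
    have hm : MeasurableSet {x : EuclideanSpace ℝ (Fin n) | x + r • v ∉ K} :=
      (hKm.preimage (by fun_prop : Measurable
        fun x : EuclideanSpace ℝ (Fin n) => x + r • v)).compl
    have : ∀ x, {r : ℝ | x + r • v ∉ K}.indicator
        (fun r => ENNReal.ofReal (s * r ^ (-s - 1))) r =
        {x : EuclideanSpace ℝ (Fin n) | x + r • v ∉ K}.indicator
          (fun _ => ENNReal.ofReal (s * r ^ (-s - 1))) x := fun x => rfl
    simp_rw [this]
    rw [lintegral_indicator hm, setLIntegral_const, Measure.restrict_apply hm, shiftLoss]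
    congr 2
    ext x; simp [and_comm]
  · refine Measurable.aemeasurable ?_
    exact (hw.comp measurable_snd).indicator hU

/-! ### Energy of translations: finiteness, homogeneity, continuity -/

section ShiftLoss

variable {n : ℕ} {K : Set (EuclideanSpace ℝ (Fin n))}

lemma shiftLoss_le (w : EuclideanSpace ℝ (Fin n)) : shiftLoss K w ≤ volume K :=
  measure_mono fun _ hx => hx.1

lemma shiftLoss_zero : shiftLoss K 0 = 0 := by simp [shiftLoss]

lemma shiftLoss_add_le (w w' : EuclideanSpace ℝ (Fin n)) :
    shiftLoss K (w + w') ≤ shiftLoss K w + shiftLoss K w' := by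
  have h : volume ((fun x => x + w) ⁻¹' {x | x ∈ K ∧ x + w' ∉ K}) = shiftLoss K w' :=
    measure_preimage_add_right _ _ _
  rw [← h]
  refine (measure_mono fun x hx => ?_).trans (measure_union_le _ _)
  by_cases hxw : x + w ∈ K
  · exact Or.inr ⟨hxw, by rw [add_assoc]; exact hx.2⟩
  · exact Or.inl ⟨hx.1, hxw⟩

lemma shiftLoss_add_volume_inter (hKm : MeasurableSet K) (w : EuclideanSpace ℝ (Fin n)) :
    shiftLoss K w + volume {x | x ∈ K ∧ x + w ∈ K} = volume K := by
  have hm : MeasurableSet {x : EuclideanSpace ℝ (Fin n) | x + w ∈ K} :=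
    hKm.preimage (by fun_prop : Measurable fun x : EuclideanSpace ℝ (Fin n) => x + w)
  rw [add_comm, ← measure_inter_add_sdiff K hm]
  rfl

/-- Shrinking a convex body towards an interior point leaves room for small translations, so its
overlap with a translate differs from it by at most a multiple of the length of the translation. -/
lemma exists_shiftLoss_le (hK : Convex ℝ K) (hKf : volume K ≠ ∞) (hKi : (interior K).Nonempty) :
    ∃ C : ℝ≥0, ∀ w, shiftLoss K w ≤ C * ENNReal.ofReal ‖w‖ := by
  obtain ⟨c, hc⟩ := hKi
  obtain ⟨δ, hδ, hball⟩ := Metric.isOpen_iff.1 isOpen_interior c hc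
  replace hball : Metric.ball c δ ⊆ K := hball.trans interior_subset
  set ρ := δ / 2 with hρ
  have hρ0 : 0 < ρ := by positivity
  set V := (volume K).toReal with hV
  have hV0 : 0 ≤ V := ENNReal.toReal_nonneg
  have hVe : volume K = ENNReal.ofReal V := (ENNReal.ofReal_toReal hKf).symm
  refine ⟨(n * V / ρ + V / ρ).toNNReal, fun w => ?_⟩
  rw [ENNReal.ofNNReal_toNNReal, ← ENNReal.ofReal_mul (by positivity)]
  rcases le_total ρ ‖w‖ with hw | hw
  · refine (shiftLoss_le w).trans (hVe.le.trans (ENNReal.ofReal_le_ofReal ?_))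
    calc V = V / ρ * ρ := by field_simp
      _ ≤ (n * V / ρ + V / ρ) * ‖w‖ := by gcongr; exact le_add_of_nonneg_left (by positivity)
  · set e := ‖w‖ / ρ with he
    have he0 : 0 ≤ e := by positivity
    have he1 : e ≤ 1 := by rw [he, div_le_one hρ0]; exact hw
    -- The shrunken copy of `K` stays in `K` under translation by `w`.
    have hsub : AffineMap.homothety c (1 - e) '' K ⊆ {x | x ∈ K ∧ x + w ∈ K} := by
      rintro _ ⟨x, hx, rfl⟩
      have hcK : c ∈ K := hball (Metric.mem_ball_self hδ)
      have hform : ∀ u : EuclideanSpace ℝ (Fin n),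
          AffineMap.homothety c (1 - e) x + e • u = (1 - e) • x + e • (c + u) := by
        intro u
        simp only [AffineMap.homothety_apply, vsub_eq_sub, vadd_eq_add]
        module
      refine ⟨?_, ?_⟩
      · have := hform 0
        rw [smul_zero, add_zero, add_zero] at this
        rw [this]
        exact hK hx hcK (by linarith) he0 (by ring)
      · rcases eq_or_ne w 0 with rfl | hw0
        · have := hform 0
          rw [smul_zero, add_zero] at this
          rw [add_zero, this, add_zero]
          exact hK hx hcK (by linarith) he0 (by ring)
        · have hwn : 0 < ‖w‖ := norm_pos_iff.2 hw0
          have hew : e • ((ρ / ‖w‖) • w) = w := by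
            rw [smul_smul, he, div_mul_div_cancel₀ hρ0.ne', div_self hwn.ne', one_smul]
          rw [← hew, hform]
          refine hK hx (hball ?_) (by linarith) he0 (by ring)
          rw [Metric.mem_ball, dist_eq_norm, add_sub_cancel_left, norm_smul, Real.norm_eq_abs,
            abs_of_pos (by positivity), div_mul_cancel₀ _ hwn.ne']
          linarith
    have hvol : ENNReal.ofReal ((1 - e) ^ n * V) ≤ volume {x | x ∈ K ∧ x + w ∈ K} := by
      refine le_trans (le_of_eq ?_) (measure_mono hsub)
      rw [Measure.addHaar_image_homothety, finrank_euclideanSpace_fin, hVe,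
        ← ENNReal.ofReal_mul (by positivity),
        abs_of_nonneg (pow_nonneg (by linarith : (0 : ℝ) ≤ 1 - e) n)]
    have hbern : 1 - n * e ≤ (1 - e) ^ n := by
      have := one_add_mul_le_pow (a := -e) (by linarith) n
      simpa [sub_eq_add_neg] using this
    have hKm : NullMeasurableSet K volume := hK.nullMeasurableSet volume
    have hdiff : shiftLoss K w ≤ volume K - volume {x | x ∈ K ∧ x + w ∈ K} := by
      have hm : NullMeasurableSet {x : EuclideanSpace ℝ (Fin n) | x ∈ K ∧ x + w ∈ K} := by
        refine hKm.inter ?_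
        exact hKm.preimage (measurePreserving_add_right volume w).quasiMeasurePreserving
      rw [← measure_sdiff (fun x hx => hx.1) hm
        (ne_top_of_le_ne_top hKf (measure_mono fun x hx => hx.1))]
      exact measure_mono fun x hx => ⟨hx.1, fun h => hx.2 h.2⟩
    refine hdiff.trans ((tsub_le_tsub hVe.le hvol).trans ?_)
    rw [← ENNReal.ofReal_sub _ (mul_nonneg (pow_nonneg (by linarith) n) hV0)]
    refine ENNReal.ofReal_le_ofReal ?_
    calc V - (1 - e) ^ n * V ≤ V - (1 - n * e) * V := by gcongr
      _ = n * V / ρ * ‖w‖ := by rw [he]; field_simp; ring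
      _ ≤ _ := by gcongr; exact le_add_of_nonneg_right (by positivity)

lemma measurable_shiftLoss_smul (hKm : MeasurableSet K) (v : EuclideanSpace ℝ (Fin n)) :
    Measurable fun r : ℝ => shiftLoss K (r • v) := by
  have hU : MeasurableSet {q : ℝ × EuclideanSpace ℝ (Fin n) | q.2 ∈ K ∧ q.2 + q.1 • v ∉ K} :=
    (measurable_snd hKm).inter (hKm.preimage (by fun_prop : Measurable
      fun q : ℝ × EuclideanSpace ℝ (Fin n) => q.2 + q.1 • v)).compl
  exact measurable_measure_prodMk_left hU

lemma shiftEnergy_add_le {s : ℝ} (hKm : MeasurableSet K) (v w : EuclideanSpace ℝ (Fin n)) :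
    shiftEnergy s K (v + w) ≤ shiftEnergy s K v + shiftEnergy s K w := by
  rw [shiftEnergy, shiftEnergy, shiftEnergy, ← lintegral_add_left']
  · refine lintegral_mono fun r => ?_
    rw [← mul_add, smul_add]
    gcongr
    exact shiftLoss_add_le _ _
  · exact (Measurable.mul (by fun_prop) (measurable_shiftLoss_smul hKm v)).aemeasurable

/-- A bound on the energy which is uniform over the unit ball. -/
lemma exists_shiftEnergy_le (hK : Convex ℝ K) (hKf : volume K ≠ ∞)
    (hKi : (interior K).Nonempty) {s : ℝ} (hs : s ∈ Ioo (0 : ℝ) 1) :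
    ∃ B : ℝ≥0, ∀ v : EuclideanSpace ℝ (Fin n), ‖v‖ ≤ 1 → shiftEnergy s K v ≤ B := by
  obtain ⟨C, hC⟩ := exists_shiftLoss_le hK hKf hKi
  have hfin1 : ∫⁻ r in Ioc (0 : ℝ) 1, ENNReal.ofReal (s * r ^ (-s)) ≠ ∞ := by
    have : IntegrableOn (fun r : ℝ => s * r ^ (-s)) (Ioc 0 1) := by
      have := (intervalIntegral.intervalIntegrable_rpow' (a := 0) (b := 1) (r := -s)
        (by linarith [hs.2])).const_mul s
      rwa [intervalIntegrable_iff_integrableOn_Ioc_of_le zero_le_one] at this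
    exact this.lintegral_lt_top.ne
  have hfin2 : ∫⁻ r in Ioi (1 : ℝ), ENNReal.ofReal (s * r ^ (-s - 1)) ≠ ∞ := by
    rw [lintegral_Ioi_mul_rpow_neg hs.1 one_pos]; exact ENNReal.ofReal_ne_top
  have hB : C * (∫⁻ r in Ioc (0 : ℝ) 1, ENNReal.ofReal (s * r ^ (-s))) +
      (∫⁻ r in Ioi (1 : ℝ), ENNReal.ofReal (s * r ^ (-s - 1))) * volume K ≠ ∞ :=
    ENNReal.add_ne_top.2 ⟨ENNReal.mul_ne_top ENNReal.coe_ne_top hfin1,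
      ENNReal.mul_ne_top hfin2 hKf⟩
  refine ⟨_, fun v hv => le_trans ?_ (ENNReal.coe_toNNReal hB).ge⟩
  rw [shiftEnergy, ← Ioc_union_Ioi_eq_Ioi zero_le_one,
    lintegral_union measurableSet_Ioi Ioc_disjoint_Ioi_same,
    ← lintegral_const_mul' _ _ ENNReal.coe_ne_top,
    ← lintegral_mul_const' _ _ hKf]
  refine add_le_add (setLIntegral_mono' measurableSet_Ioc fun r hr => ?_)
    (lintegral_mono fun r => mul_le_mul_right (shiftLoss_le _) _)
  have hr0 : 0 < r := hr.1
  calc _ ≤ ENNReal.ofReal (s * r ^ (-s - 1)) * (C * ENNReal.ofReal r) := by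
        gcongr
        refine (hC _).trans ?_
        gcongr
        rw [norm_smul, Real.norm_eq_abs, abs_of_pos hr0]
        exact mul_le_of_le_one_right hr0.le hv
    _ = C * ENNReal.ofReal (s * r ^ (-s - 1) * r) := by
        rw [ENNReal.ofReal_mul' hr0.le]; ring
    _ = _ := by
        rw [mul_assoc s, Real.rpow_sub_one hr0.ne', div_mul_cancel₀ _ hr0.ne']

lemma radialFun_smul_le {c : ℝ} (hc : 0 < c) (x v : EuclideanSpace ℝ (Fin n)) :
    ENNReal.ofReal c * radialFun K x (c • v) ≤ radialFun K x v := by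
  rw [radialFun, ENNReal.mul_iSup]
  refine iSup_le fun t => ?_
  rw [ENNReal.mul_iSup]
  refine iSup_le fun ht => ?_
  rw [← ENNReal.ofReal_coe_nnreal, ← ENNReal.ofReal_mul hc.le]
  refine le_radialFun (by positivity) ?_
  rwa [mul_comm, mul_smul]

lemma radialFun_smul {c : ℝ} (hc : 0 < c) (x v : EuclideanSpace ℝ (Fin n)) :
    radialFun K x (c • v) = ENNReal.ofReal c⁻¹ * radialFun K x v := by
  have hcc : ENNReal.ofReal c⁻¹ * ENNReal.ofReal c = 1 := by
    rw [← ENNReal.ofReal_mul (by positivity), inv_mul_cancel₀ hc.ne', ENNReal.ofReal_one]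
  refine le_antisymm ?_ ?_
  · calc _ = ENNReal.ofReal c⁻¹ * (ENNReal.ofReal c * radialFun K x (c • v)) := by
          rw [← mul_assoc, hcc, one_mul]
      _ ≤ _ := by gcongr; exact radialFun_smul_le hc x v
  · have := radialFun_smul_le (K := K) (inv_pos.2 hc) x (c • v)
    rwa [inv_smul_smul₀ hc.ne'] at this

lemma shiftEnergy_smul (hK : Convex ℝ K) (hKm : MeasurableSet K) {s : ℝ} (hs : 0 < s) {c : ℝ}
    (hc : 0 < c) (v : EuclideanSpace ℝ (Fin n)) :
    shiftEnergy s K (c • v) = ENNReal.ofReal (c ^ s) * shiftEnergy s K v := by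
  rw [← setLIntegral_radialFun_rpow hK hKm hs, ← setLIntegral_radialFun_rpow hK hKm hs,
    ← lintegral_const_mul' _ _ ENNReal.ofReal_ne_top]
  refine lintegral_congr fun x => ?_
  have hci : ENNReal.ofReal c⁻¹ ≠ 0 := by simpa using hc
  have hpow : ENNReal.ofReal c⁻¹ ^ (-s) = ENNReal.ofReal (c ^ s) := by
    rw [ENNReal.ofReal_rpow_of_pos (by positivity), Real.rpow_neg (by positivity),
      Real.inv_rpow hc.le, inv_inv]
  rw [radialFun_smul hc, ← hpow]
  rcases eq_or_ne (radialFun K x v) 0 with h0 | h0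
  · rw [h0, mul_zero, ENNReal.zero_rpow_of_neg (by linarith), ENNReal.mul_top]
    rw [hpow]
    simpa using Real.rpow_pos_of_pos hc s
  rcases eq_or_ne (radialFun K x v) ∞ with h1 | h1
  · rw [h1, ENNReal.mul_top hci, ENNReal.top_rpow_of_neg (by linarith), mul_zero]
  · exact ENNReal.mul_rpow_of_ne_top ENNReal.ofReal_ne_top h1 _

lemma shiftEnergy_zero {s : ℝ} : shiftEnergy s K 0 = 0 := by
  simp [shiftEnergy, shiftLoss_zero]

lemma exists_shiftEnergy_le_rpow_norm (hK : Convex ℝ K) (hKm : MeasurableSet K)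
    (hKf : volume K ≠ ∞) (hKi : (interior K).Nonempty) {s : ℝ} (hs : s ∈ Ioo (0 : ℝ) 1) :
    ∃ B : ℝ≥0, ∀ v : EuclideanSpace ℝ (Fin n),
      shiftEnergy s K v ≤ ENNReal.ofReal (B * ‖v‖ ^ s) := by
  obtain ⟨B, hB⟩ := exists_shiftEnergy_le hK hKf hKi hs
  refine ⟨B, fun v => ?_⟩
  rcases eq_or_ne v 0 with rfl | hv
  · simp [shiftEnergy_zero]
  · have hv0 : 0 < ‖v‖ := norm_pos_iff.2 hv
    have h := shiftEnergy_smul hK hKm hs.1 hv0 (‖v‖⁻¹ • v)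
    rw [smul_inv_smul₀ hv0.ne'] at h
    rw [h, mul_comm (B : ℝ), ENNReal.ofReal_mul (by positivity), ENNReal.ofReal_coe_nnreal]
    gcongr
    refine hB _ ?_
    rw [norm_smul, norm_inv, norm_norm, inv_mul_cancel₀ hv0.ne']

lemma continuous_shiftEnergy_toReal (hK : Convex ℝ K) (hKm : MeasurableSet K)
    (hKf : volume K ≠ ∞) (hKi : (interior K).Nonempty) {s : ℝ} (hs : s ∈ Ioo (0 : ℝ) 1) :
    Continuous fun v : EuclideanSpace ℝ (Fin n) => (shiftEnergy s K v).toReal := by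
  obtain ⟨B, hB⟩ := exists_shiftEnergy_le_rpow_norm hK hKm hKf hKi hs
  have hfin : ∀ v, shiftEnergy s K v ≠ ∞ := fun v =>
    ne_top_of_le_ne_top ENNReal.ofReal_ne_top (hB v)
  have hone : ∀ v w : EuclideanSpace ℝ (Fin n), (shiftEnergy s K v).toReal ≤
      (shiftEnergy s K w).toReal + B * ‖v - w‖ ^ s := by
    intro v w
    have h := (shiftEnergy_add_le (s := s) hKm w (v - w)).trans
      (add_le_add_right (hB (v - w)) _)
    rw [add_sub_cancel] at h
    have h2 := ENNReal.toReal_mono (ENNReal.add_ne_top.2 ⟨hfin w, ENNReal.ofReal_ne_top⟩) h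
    rwa [ENNReal.toReal_add (hfin w) ENNReal.ofReal_ne_top,
      ENNReal.toReal_ofReal (by positivity)] at h2
  rw [continuous_iff_continuousAt]
  intro w
  rw [ContinuousAt, tendsto_iff_dist_tendsto_zero]
  have hlim : Filter.Tendsto (fun v => (B : ℝ) * ‖v - w‖ ^ s) (nhds w) (nhds 0) := by
    have : Continuous fun v : EuclideanSpace ℝ (Fin n) => (B : ℝ) * ‖v - w‖ ^ s :=
      continuous_const.mul (Continuous.rpow_const (by fun_prop) fun _ => Or.inr hs.1.le)
    have h := this.tendsto w
    simpa [Real.zero_rpow hs.1.ne'] using h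
  refine squeeze_zero (fun _ => dist_nonneg) (fun v => ?_) hlim
  rw [Real.dist_eq, abs_le]
  have h1 := hone v w
  have h2 := hone w v
  rw [norm_sub_rev] at h2
  constructor <;> linarith

end ShiftLoss

/-! ### Second differences of the overlap of a planar body with its translates -/

/-- The length of the overlap of the interval `[l, u]` with the translate `[l' - h, u' - h]`, as a
signed quantity: it is negative when the intervals are disjoint. -/
noncomputable def signedOverlap (l u l' u' h : ℝ) : ℝ := min u (u' - h) - max l (l' - h)

lemma volume_Icc_overlap (l u l' u' h : ℝ) :
    volume {y : ℝ | y ∈ Icc l u ∧ y + h ∈ Icc l' u'} = ENNReal.ofReal (signedOverlap l u l' u' h) := by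
  have : {y : ℝ | y ∈ Icc l u ∧ y + h ∈ Icc l' u'} = Icc (max l (l' - h)) (min u (u' - h)) := by
    ext y
    simp only [mem_ofPred_eq, mem_Icc, max_le_iff, le_min_iff, sub_le_iff_le_add, le_sub_iff_add_le]
    tauto
  rw [this, Real.volume_Icc, signedOverlap]

section Interval

variable {l u l' u' h : ℝ} (hl : l ≤ 0) (hu : 0 ≤ u) (hl' : l' ≤ 0) (hu' : 0 ≤ u') (hh : 0 ≤ h)
include hl hu hl' hu' hh

/-- The signed overlap is concave in the translation, hence so is the overlap itself as long as the
translated intervals meet. -/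
lemma overlap_add_le_of_le (h1 : h ≤ u' - l) (h2 : h ≤ u - l') :
    max (signedOverlap l u l' u' h) 0 + max (signedOverlap l u l' u' (-h)) 0 ≤
      2 * signedOverlap l u l' u' 0 := by
  have p1 : 0 ≤ signedOverlap l u l' u' h := by unfold signedOverlap; grind
  have p2 : 0 ≤ signedOverlap l u l' u' (-h) := by unfold signedOverlap; grind
  rw [max_eq_left p1, max_eq_left p2]
  unfold signedOverlap; grind

lemma overlap_add_le_of_nonpos (hu0 : u = 0) (hu0' : u' = 0) :
    max (signedOverlap l u l' u' h) 0 + max (signedOverlap l u l' u' (-h)) 0 ≤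
      2 * signedOverlap l u l' u' 0 := by
  unfold signedOverlap; grind

lemma overlap_add_le_of_nonneg (hl0 : l = 0) (hl0' : l' = 0) :
    max (signedOverlap l u l' u' h) 0 + max (signedOverlap l u l' u' (-h)) 0 ≤
      2 * signedOverlap l u l' u' 0 := by
  unfold signedOverlap; grind

lemma overlap_add_le_add :
    max (signedOverlap l u l' u' h) 0 + max (signedOverlap l u l' u' (-h)) 0 ≤
      2 * signedOverlap l u l' u' 0 + 2 * h := by
  unfold signedOverlap; grind

end Interval

section PlaneBody

variable {S : Set (ℝ × ℝ)} {D : ℝ}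

/-- A convex set contains the triangle over its base `[(0, 0), (D, 0)]` with any of its points as
apex, and the triangle contains a symmetric tent. -/
lemma tent_mem (hS : Convex ℝ S) (hD : 0 < D) (h0 : ((0 : ℝ), (0 : ℝ)) ∈ S) (h1 : (D, (0 : ℝ)) ∈ S)
    {x₀ y₀ : ℝ} (hq : (x₀, y₀) ∈ S) (hx₀ : x₀ ∈ Icc 0 D) {x : ℝ} (hx : x ∈ Icc 0 D) :
    (x, y₀ / D * min x (D - x)) ∈ S := by
  set μ := min x (D - x) / D with hμ
  have hμx : μ * D ≤ x := by rw [hμ, div_mul_cancel₀ _ hD.ne']; exact min_le_left _ _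
  have hμx' : μ * D ≤ D - x := by rw [hμ, div_mul_cancel₀ _ hD.ne']; exact min_le_right _ _
  have hμ0 : 0 ≤ μ := div_nonneg (le_min hx.1 (by linarith [hx.2])) hD.le
  set ν := (x - μ * x₀) / D with hν
  have hν0 : 0 ≤ ν := div_nonneg (by nlinarith [hx₀.2]) hD.le
  have hνD : ν * D = x - μ * x₀ := div_mul_cancel₀ _ hD.ne'
  have hω : 0 ≤ 1 - μ - ν := by
    refine nonneg_of_mul_nonneg_left (b := D) ?_ hD
    nlinarith [mul_nonneg hμ0 hx₀.1]
  have := hS.sum_mem (t := Finset.univ) (w := ![μ, ν, 1 - μ - ν])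
    (z := ![(x₀, y₀), (D, (0 : ℝ)), ((0 : ℝ), (0 : ℝ))])
    (by intro i _; fin_cases i; exacts [hμ0, hν0, hω]) (by simp [Fin.sum_univ_three])
    (by intro i _; fin_cases i <;> simpa)
  convert this using 1
  simp only [Fin.sum_univ_three, Matrix.cons_val_zero, Matrix.cons_val_one, Matrix.cons_val,
    Prod.smul_mk, smul_eq_mul, mul_zero, Prod.mk_add_mk, add_zero]
  rw [hνD, hμ]
  ext
  · simp
  · simp only; ring

/-- The vertical sections over the base are intervals around `0`. -/
lemma exists_section_eq_Icc (hS : Convex ℝ S) (hSc : IsCompact S) (hD : 0 < D)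
    (h0 : ((0 : ℝ), (0 : ℝ)) ∈ S) (h1 : (D, (0 : ℝ)) ∈ S) {x : ℝ} (hx : x ∈ Icc 0 D) :
    ∃ l u : ℝ, l ≤ 0 ∧ 0 ≤ u ∧ ∀ y, (x, y) ∈ S ↔ y ∈ Icc l u := by
  have hx0 : (x, (0 : ℝ)) ∈ S := by
    simpa using tent_mem hS hD h0 h1 h0 ⟨le_rfl, hD.le⟩ hx
  set A : Set ℝ := {y | (x, y) ∈ S} with hA
  have hAne : A.Nonempty := ⟨0, hx0⟩
  have hAconv : Convex ℝ A := by
    intro y hy y' hy' a b ha hb hab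
    have := hS hy hy' ha hb hab
    have e : a • (x, y) + b • (x, y') = (x, a • y + b • y') := by
      ext
      · simp only [Prod.smul_mk, smul_eq_mul, Prod.mk_add_mk]
        rw [← add_mul, hab, one_mul]
      · simp
    rwa [e] at this
  have hAc : IsCompact A := by
    have : A ⊆ Prod.snd '' S := fun y hy => ⟨_, hy, rfl⟩
    refine (hSc.image continuous_snd).of_isClosed_subset ?_ this
    exact hSc.isClosed.preimage (by fun_prop : Continuous fun y : ℝ => (x, y))
  have hAeq := eq_Icc_of_connected_compact ⟨hAne, hAconv.isPreconnected⟩ hAc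
  have h0A : (0 : ℝ) ∈ Icc (sInf A) (sSup A) := hAeq ▸ hx0
  exact ⟨sInf A, sSup A, h0A.1, h0A.2, fun y => by rw [← hAeq]; rfl⟩

lemma volume_plane_overlap (hS : MeasurableSet S) (r h : ℝ) :
    volume {q : ℝ × ℝ | q ∈ S ∧ q + (r, h) ∈ S} =
      ∫⁻ x, volume {y : ℝ | (x, y) ∈ S ∧ (x + r, y + h) ∈ S} := by
  have hm : MeasurableSet {q : ℝ × ℝ | q ∈ S ∧ q + (r, h) ∈ S} :=
    hS.inter (hS.preimage (by fun_prop : Measurable fun q : ℝ × ℝ => q + (r, h)))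
  rw [Measure.volume_eq_prod, Measure.prod_apply hm]
  rfl

/-- The reduction to vertical sections: if the sections satisfy the second difference inequality up
to an error `2 * h * e`, then so do the areas. -/
lemma volume_plane_overlap_add_le (hS : MeasurableSet S) (hSD : ∀ q ∈ S, q.1 ∈ Icc 0 D) {r h : ℝ}
    (e : ℝ≥0∞)
    (H : ∀ x ∈ Icc 0 (D - r),
      volume {y : ℝ | (x, y) ∈ S ∧ (x + r, y + h) ∈ S} +
        volume {y : ℝ | (x, y) ∈ S ∧ (x + r, y + -h) ∈ S} ≤
      2 * volume {y : ℝ | (x, y) ∈ S ∧ (x + r, y + 0) ∈ S} + e) :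
    volume {q : ℝ × ℝ | q ∈ S ∧ q + (r, h) ∈ S} + volume {q : ℝ × ℝ | q ∈ S ∧ q + (r, -h) ∈ S} ≤
      2 * volume {q : ℝ × ℝ | q ∈ S ∧ q + (r, 0) ∈ S} + e * ENNReal.ofReal (D - r) := by
  have hmeas : ∀ k : ℝ, Measurable fun x : ℝ =>
      volume {y : ℝ | (x, y) ∈ S ∧ (x + r, y + k) ∈ S} := by
    intro k
    have hm : MeasurableSet {q : ℝ × ℝ | q ∈ S ∧ q + (r, k) ∈ S} :=
      hS.inter (hS.preimage (by fun_prop : Measurable fun q : ℝ × ℝ => q + (r, k)))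
    exact measurable_measure_prodMk_left hm
  rw [volume_plane_overlap hS, volume_plane_overlap hS, volume_plane_overlap hS,
    ← lintegral_add_left (hmeas h), ← lintegral_const_mul _ (hmeas 0)]
  have hE : e * ENNReal.ofReal (D - r) = ∫⁻ x, (Icc 0 (D - r)).indicator (fun _ => e) x := by
    rw [lintegral_indicator measurableSet_Icc, setLIntegral_const, Real.volume_Icc, sub_zero]
  rw [hE, ← lintegral_add_left ((hmeas 0).const_mul 2)]
  refine lintegral_mono fun x => ?_
  by_cases hx : x ∈ Icc 0 (D - r)
  · rw [indicator_of_mem hx]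
    exact H x hx
  · have hempty : ∀ k : ℝ, {y : ℝ | (x, y) ∈ S ∧ (x + r, y + k) ∈ S} = ∅ := by
      intro k
      refine eq_empty_of_forall_notMem fun y hy => hx ?_
      have h1 := (hSD _ hy.1).1
      have h2 := (hSD _ hy.2).2
      exact ⟨h1, by simp only at h2; linarith⟩
    simp [hempty]

lemma ofReal_add_le_of_max {x y z e : ℝ} (h : max x 0 + max y 0 ≤ 2 * z + e) :
    ENNReal.ofReal x + ENNReal.ofReal y ≤ 2 * ENNReal.ofReal z + ENNReal.ofReal e := by
  have hx : ENNReal.ofReal x = ENNReal.ofReal (max x 0) := by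
    rw [ENNReal.ofReal_max, ENNReal.ofReal_zero, max_eq_left (zero_le)]
  have hy : ENNReal.ofReal y = ENNReal.ofReal (max y 0) := by
    rw [ENNReal.ofReal_max, ENNReal.ofReal_zero, max_eq_left (zero_le)]
  rw [hx, hy, ← ENNReal.ofReal_add (le_max_right _ _) (le_max_right _ _)]
  refine (ENNReal.ofReal_le_ofReal h).trans (ENNReal.ofReal_add_le.trans ?_)
  rw [ENNReal.ofReal_mul zero_le_two, ENNReal.ofReal_ofNat]

/-- The area of the overlap of a convex body with its translates, when the body lies between two
parallel lines through the endpoints of a chord: the second difference, along these lines, at a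
translation along the chord is nonpositive, except for a small error at translations of almost the
length of the chord. -/
theorem exists_plane_overlap_second_difference (hS : Convex ℝ S) (hSc : IsCompact S) (hD : 0 < D)
    (h0 : ((0 : ℝ), (0 : ℝ)) ∈ S) (h1 : (D, (0 : ℝ)) ∈ S) (hSD : ∀ q ∈ S, q.1 ∈ Icc 0 D) :
    ∃ C : ℝ, 0 ≤ C ∧ ∃ t₀ : ℝ, 0 < t₀ ∧ ∀ t ∈ Ioo 0 t₀, ∀ r : ℝ, 0 < r →
      volume {q : ℝ × ℝ | q ∈ S ∧ q + (r, r * t) ∈ S} +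
        volume {q : ℝ × ℝ | q ∈ S ∧ q + (r, -(r * t)) ∈ S} ≤
      2 * volume {q : ℝ × ℝ | q ∈ S ∧ q + (r, 0) ∈ S} +
        (Icc (D - C * t) D).indicator (fun _ => ENNReal.ofReal (C * t ^ 2)) r := by
  have hSm : MeasurableSet S := hSc.measurableSet
  have hsec := fun x (hx : x ∈ Icc 0 D) => exists_section_eq_Icc hS hSc hD h0 h1 hx
  have hvol : ∀ x r : ℝ, ∀ l u l' u' : ℝ, (∀ y, (x, y) ∈ S ↔ y ∈ Icc l u) →
      (∀ y, (x + r, y) ∈ S ↔ y ∈ Icc l' u') → ∀ h : ℝ,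
      volume {y : ℝ | (x, y) ∈ S ∧ (x + r, y + h) ∈ S} =
        ENNReal.ofReal (signedOverlap l u l' u' h) := by
    intro x r l u l' u' hlu hlu' h
    rw [← volume_Icc_overlap]
    congr 1; ext y; simp only [mem_ofPred_eq, hlu, hlu']
  by_cases hcase : (∃ q ∈ S, 0 < q.2) ∧ ∃ q ∈ S, q.2 < 0
  · obtain ⟨⟨⟨x₁, y₁⟩, hq1, hy1⟩, ⟨x₂, y₂⟩, hq2, hy2⟩ := hcase
    simp only at hy1 hy2
    obtain ⟨m, hm, hm1, hm2⟩ : ∃ m : ℝ, 0 < m ∧ m ≤ y₁ / D ∧ y₂ / D ≤ -m := by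
      refine ⟨min (y₁ / D) (-(y₂ / D)), lt_min (by positivity) ?_, min_le_left _ _, ?_⟩
      · have := div_neg_of_neg_of_pos hy2 hD; linarith
      · linarith [min_le_right (y₁ / D) (-(y₂ / D))]
    refine ⟨D / m + 2 * D ^ 2 / m, by positivity, m, hm, fun t ht r hr => ?_⟩
    have ht0 : 0 < t := ht.1
    set C := D / m + 2 * D ^ 2 / m with hC
    have hCt : D / m * t ≤ C * t := by
      gcongr; rw [hC]; exact le_add_of_nonneg_right (by positivity)
    by_cases hrD : r ∈ Icc (D - D / m * t) D
    · rw [indicator_of_mem (show r ∈ Icc (D - C * t) D from ⟨by linarith [hrD.1], hrD.2⟩)]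
      refine (volume_plane_overlap_add_le hSm hSD (ENNReal.ofReal (2 * (r * t)))
        fun x hx => ?_).trans ?_
      · obtain ⟨l, u, hl, hu, hlu⟩ := hsec x ⟨hx.1, by linarith [hx.2]⟩
        obtain ⟨l', u', hl', hu', hlu'⟩ := hsec (x + r) ⟨by linarith [hx.1], by linarith [hx.2]⟩
        simp_rw [hvol x r l u l' u' hlu hlu']
        exact ofReal_add_le_of_max (overlap_add_le_add hl hu hl' hu' (by positivity))
      · gcongr
        rw [← ENNReal.ofReal_mul (by positivity)]
        refine ENNReal.ofReal_le_ofReal ?_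
        calc 2 * (r * t) * (D - r) ≤ 2 * (D * t) * (D / m * t) := by
              gcongr
              · linarith [hrD.2]
              · exact hrD.2
              · linarith [hrD.1]
          _ = 2 * D ^ 2 / m * t ^ 2 := by ring
          _ ≤ C * t ^ 2 := by
              gcongr; rw [hC]; exact le_add_of_nonneg_left (by positivity)
    · refine (volume_plane_overlap_add_le hSm hSD 0 fun x hx => ?_).trans
        (add_le_add_right (by simp) _)
      have hrD' : r < D - D / m * t := by
        by_contra! h
        exact hrD ⟨h, by linarith [hx.1, hx.2]⟩
      have hx1 : x ∈ Icc 0 D := ⟨hx.1, by linarith [hx.2]⟩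
      have hx2 : x + r ∈ Icc 0 D := ⟨by linarith [hx.1], by linarith [hx.2]⟩
      obtain ⟨l, u, hl, hu, hlu⟩ := hsec x hx1
      obtain ⟨l', u', hl', hu', hlu'⟩ := hsec (x + r) hx2
      simp_rw [hvol x r l u l' u' hlu hlu']
      -- The tents over and under the chord keep the sections away from `0`.
      have htent : ∀ x' ∈ Icc 0 D, ∀ l u : ℝ, (∀ y, (x', y) ∈ S ↔ y ∈ Icc l u) →
          m * min x' (D - x') ≤ u ∧ l ≤ -(m * min x' (D - x')) := by
        intro x' hx' l u hlu
        have hmin : 0 ≤ min x' (D - x') := le_min hx'.1 (by linarith [hx'.2])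
        have a1 := ((hlu _).1 (tent_mem hS hD h0 h1 hq1 (hSD _ hq1) hx')).2
        have a2 := ((hlu _).1 (tent_mem hS hD h0 h1 hq2 (hSD _ hq2) hx')).1
        constructor <;> nlinarith
      obtain ⟨b1, b2⟩ := htent x hx1 l u hlu
      obtain ⟨b3, b4⟩ := htent (x + r) hx2 l' u' hlu'
      have hmin : min r (D - r) ≤ min x (D - x) + min (x + r) (D - (x + r)) := by
        have := hx.1
        have := hx.2
        grind
      have hrt : r * t ≤ m * min r (D - r) := by
        rcases min_choice r (D - r) with h | h <;> rw [h]
        · nlinarith [ht.2]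
        · have : D / m * t * m = D * t := by field_simp
          nlinarith [hx.1, hx.2]
      have := mul_le_mul_of_nonneg_left hmin hm.le
      have h3 := ofReal_add_le_of_max (e := 0) (by
        simpa using overlap_add_le_of_le hl hu hl' hu' (h := r * t) (by positivity)
          (by linarith) (by linarith))
      simpa using h3
  · refine ⟨0, le_rfl, 1, one_pos, fun t ht r hr => ?_⟩
    have ht0 : 0 < t := ht.1
    refine (volume_plane_overlap_add_le hSm hSD 0 fun x hx => ?_).trans
      (add_le_add_right (by simp) _)
    have hx1 : x ∈ Icc 0 D := ⟨hx.1, by linarith [hx.2]⟩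
    have hx2 : x + r ∈ Icc 0 D := ⟨by linarith [hx.1], by linarith [hx.2]⟩
    obtain ⟨l, u, hl, hu, hlu⟩ := hsec x hx1
    obtain ⟨l', u', hl', hu', hlu'⟩ := hsec (x + r) hx2
    simp_rw [hvol x r l u l' u' hlu hlu']
    have h3 := ofReal_add_le_of_max (x := signedOverlap l u l' u' (r * t))
      (y := signedOverlap l u l' u' (-(r * t))) (z := signedOverlap l u l' u' 0) (e := 0) (by
      rw [add_zero]
      have mu := (hlu u).2 ⟨by linarith, le_rfl⟩
      have ml := (hlu l).2 ⟨le_rfl, by linarith⟩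
      have mu' := (hlu' u').2 ⟨by linarith, le_rfl⟩
      have ml' := (hlu' l').2 ⟨le_rfl, by linarith⟩
      by_cases hup : ∃ q ∈ S, 0 < q.2
      · have hdown : ∀ q ∈ S, 0 ≤ q.2 := by
          intro q hq
          by_contra! h
          exact hcase ⟨hup, q, hq, h⟩
        exact overlap_add_le_of_nonneg hl hu hl' hu' (by positivity)
          (le_antisymm hl (hdown _ ml)) (le_antisymm hl' (hdown _ ml'))
      · push Not at hup
        exact overlap_add_le_of_nonpos hl hu hl' hu' (by positivity)
          (le_antisymm (hup _ mu) hu) (le_antisymm (hup _ mu') hu'))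
    simpa using h3

end PlaneBody

/-! ### Supporting strips and second differences of the energy -/

lemma exists_obliqueCoords {E : Type*} [NormedAddCommGroup E] [NormedSpace ℝ E]
    (hE : Module.finrank ℝ E = 2) {z τ : E} (h : LinearIndependent ℝ ![z, τ]) :
    ∃ e : (ℝ × ℝ) ≃L[ℝ] E, ∀ c, e c = c.1 • z + c.2 • τ := by
  have : FiniteDimensional ℝ E := .of_finrank_eq_succ hE
  let f : ℝ × ℝ →ₗ[ℝ] E :=
    (LinearMap.toSpanSingleton ℝ _ z).coprod (LinearMap.toSpanSingleton ℝ _ τ)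
  have hfa : ∀ c : ℝ × ℝ, f c = c.1 • z + c.2 • τ := fun c => by simp [f]
  have hf : Function.Injective f := by
    rw [← LinearMap.ker_eq_bot, LinearMap.ker_eq_bot']
    intro c hc
    rw [hfa] at hc
    have := LinearIndependent.pair_iff.1 h _ _ hc
    exact Prod.ext this.1 this.2
  exact ⟨(LinearEquiv.ofInjectiveOfFinrankEq f hf (by simp [hE])).toContinuousLinearEquiv, hfa⟩

lemma exists_volume_eq_mul_volume_preimage {E : Type*} [NormedAddCommGroup E] [NormedSpace ℝ E]
    [MeasureSpace E] [BorelSpace E] [FiniteDimensional ℝ E]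
    [(volume : Measure E).IsAddHaarMeasure] (e : (ℝ × ℝ) ≃L[ℝ] E) :
    ∃ κ : ℝ≥0, ∀ (q : E) (A : Set E), MeasurableSet A →
      volume A = κ * volume {c : ℝ × ℝ | q + e c ∈ A} := by
  have := e.isAddHaarMeasure_map volume
  have hμ := Measure.isAddLeftInvariant_eq_smul (volume : Measure E) (Measure.map e volume)
  refine ⟨(volume : Measure E).addHaarScalarFactor (Measure.map e volume), fun q A hA => ?_⟩
  have hA' : MeasurableSet ((fun x => q + x) ⁻¹' A) :=
    hA.preimage (by fun_prop : Measurable fun x => q + x)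
  rw [← measure_preimage_add volume q A, DFunLike.congr_fun hμ ((fun x => q + x) ⁻¹' A),
    Measure.smul_apply, Measure.map_apply e.continuous.measurable hA', ENNReal.smul_def,
    smul_eq_mul]
  rfl

/-- The longest chord of a convex body in a given direction. -/
lemma exists_maximal_chord {E : Type*} [NormedAddCommGroup E] [NormedSpace ℝ E] {K : Set E}
    (hKc : IsCompact K) (hKi : (interior K).Nonempty) {z : E} (hz : z ≠ 0) :
    ∃ (p : E) (D : ℝ), 0 < D ∧ p ∈ K ∧ p + D • z ∈ K ∧ ∀ (q : E) (t : ℝ), q ∈ K → q + t • z ∈ K → t ≤ D := by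
  have hz0 : 0 < ‖z‖ := norm_pos_iff.2 hz
  set M := Metric.diam K / ‖z‖ with hM
  let A : Set (E × ℝ) := {x | x ∈ K ×ˢ Icc 0 M ∧ x.1 + x.2 • z ∈ K}
  have hA : IsCompact A := by
    refine (hKc.prod isCompact_Icc).inter_right ?_
    exact hKc.isClosed.preimage (by fun_prop : Continuous fun x : E × ℝ => x.1 + x.2 • z)
  have hmem : ∀ (q : E) (t : ℝ), q ∈ K → q + t • z ∈ K → 0 ≤ t → (q, t) ∈ A := by
    intro q t hq hqt ht
    refine ⟨⟨hq, ht, ?_⟩, hqt⟩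
    rw [hM, le_div_iff₀ hz0]
    have := Metric.dist_le_diam_of_mem hKc.isBounded hqt hq
    rwa [dist_eq_norm, add_sub_cancel_left, norm_smul, Real.norm_of_nonneg ht] at this
  obtain ⟨c, hc⟩ := hKi
  obtain ⟨ε, hε, hball⟩ : ∃ ε : ℝ, 0 < ε ∧ c + ε • z ∈ K := by
    have hcont : Filter.Tendsto (fun t : ℝ => c + t • z) (nhdsWithin 0 (Ioi 0)) (nhds c) := by
      have := (by fun_prop : Continuous fun t : ℝ => c + t • z).tendsto 0
      rw [zero_smul, add_zero] at this
      exact this.mono_left nhdsWithin_le_nhds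
    obtain ⟨t, h1, h2⟩ := ((hcont.eventually (mem_interior_iff_mem_nhds.1 hc)).and
      self_mem_nhdsWithin).exists
    exact ⟨t, h2, h1⟩
  have hεA := hmem c ε (interior_subset hc) hball hε.le
  obtain ⟨⟨p, D⟩, hpD, hmax⟩ := hA.exists_isMaxOn ⟨_, hεA⟩ continuous_snd.continuousOn
  have hmax : ∀ x ∈ A, x.2 ≤ D := fun x hx => hmax hx
  have hD : 0 < D := hε.trans_le (hmax _ hεA)
  refine ⟨p, D, hD, hpD.1.1, hpD.2, fun q t hq hqt => ?_⟩
  rcases le_total 0 t with ht | ht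
  · exact hmax _ (hmem q t hq hqt ht)
  · linarith

/-- At the ends of a longest chord in a given direction a planar convex body has parallel supporting
lines. -/
lemma exists_strip {E : Type*} [NormedAddCommGroup E] [NormedSpace ℝ E]
    (hE : Module.finrank ℝ E = 2) {K : Set E} (hK : Convex ℝ K)
    (hKc : IsCompact K) (hKi : (interior K).Nonempty) {z : E} (hz : z ≠ 0) :
    ∃ (p τ : E) (D : ℝ), 0 < D ∧ p ∈ K ∧ p + D • z ∈ K ∧ LinearIndependent ℝ ![z, τ] ∧
      ∀ x y : ℝ, p + (x • z + y • τ) ∈ K → x ∈ Icc 0 D := by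
  obtain ⟨p, D, hD, hp, hpD, hmax⟩ := exists_maximal_chord hKc hKi hz
  have hK' : Convex ℝ ((fun x => x + D • z) ⁻¹' K) := hK.translate_preimage_left _
  -- Otherwise the chord could be extended.
  have hdisj : Disjoint (interior K) ((fun x => x + D • z) ⁻¹' K) := by
    rw [Set.disjoint_left]
    intro c hc hcD
    have hcont : Filter.Tendsto (fun t : ℝ => c - t • z) (nhdsWithin 0 (Ioi 0)) (nhds c) := by
      have := (by fun_prop : Continuous fun t : ℝ => c - t • z).tendsto 0
      rw [zero_smul, sub_zero] at this
      exact this.mono_left nhdsWithin_le_nhds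
    obtain ⟨t, h1, h2⟩ := ((hcont.eventually (mem_interior_iff_mem_nhds.1 hc)).and
      self_mem_nhdsWithin).exists
    have h2 : 0 < t := h2
    have := hmax (c - t • z) (D + t) h1 (by
      have e : c - t • z + (D + t) • z = c + D • z := by module
      rw [e]; exact hcD)
    linarith
  obtain ⟨f, u, hf1, hf2⟩ := geometric_hahn_banach_open hK.interior isOpen_interior hK' hdisj
  have hup : ∀ x ∈ K, f x ≤ u := by
    intro x hx
    have hx' : x ∈ closure (interior K) := by
      rw [hK.closure_interior_eq_closure_of_nonempty_interior hKi]
      exact subset_closure hx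
    have hcl : IsClosed {x | f x ≤ u} := isClosed_le f.continuous continuous_const
    exact closure_minimal (fun y hy => (hf1 y hy).le) hcl hx'
  have hlow : ∀ x ∈ K, u + D * f z ≤ f x := by
    intro x hx
    have := hf2 (x - D • z) (by simpa using hx)
    rw [map_sub, map_smul, smul_eq_mul] at this
    linarith
  have hpu : f p = u := le_antisymm (hup p hp) (hf2 p hpD)
  have hfz : f z < 0 := by
    obtain ⟨c, hc⟩ := hKi
    have h1 := hf1 c hc
    have h2 := hlow c (interior_subset hc)
    by_contra! h
    nlinarith [mul_nonneg hD.le h]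
  have : FiniteDimensional ℝ E := .of_finrank_eq_succ hE
  have hker : LinearMap.ker (f : E →ₗ[ℝ] ℝ) ≠ ⊥ :=
    LinearMap.ker_ne_bot_of_finrank_lt (by simp [hE])
  obtain ⟨τ, hτ, hτ0⟩ := Submodule.exists_mem_ne_zero_of_ne_bot hker
  have hτ : f τ = 0 := hτ
  refine ⟨p, τ, D, hD, hp, hpD, ?_, fun x y hxy => ?_⟩
  · rw [LinearIndependent.pair_iff]
    intro a b hab
    have h1 := congrArg f hab
    simp only [map_add, map_smul, hτ, smul_eq_mul, mul_zero, add_zero, map_zero,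
      mul_eq_zero, hfz.ne, or_false] at h1
    subst h1
    rw [zero_smul, zero_add, smul_eq_zero] at hab
    exact ⟨rfl, hab.resolve_right hτ0⟩
  · have h1 := hup _ hxy
    have h2 := hlow _ hxy
    simp only [map_add, map_smul, hτ, hpu, smul_eq_mul, mul_zero, add_zero] at h1 h2
    constructor
    · by_contra! h
      nlinarith
    · by_contra! h
      nlinarith

/-- The second difference of the energy at `z`, in the direction of the supporting lines at the ends
of a longest chord parallel to `z`, is nonnegative up to an error of third order. -/
theorem exists_shiftEnergy_second_difference {K : Set (EuclideanSpace ℝ (Fin 2))}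
    (hK : Convex ℝ K) (hKc : IsCompact K) (hKi : (interior K).Nonempty) {s : ℝ} (hs : 0 < s)
    {z : EuclideanSpace ℝ (Fin 2)} (hz : z ≠ 0) :
    ∃ τ, LinearIndependent ℝ ![z, τ] ∧ ∃ C : ℝ, 0 ≤ C ∧ ∃ t₀ : ℝ, 0 < t₀ ∧ ∀ t ∈ Ioo 0 t₀,
      2 * shiftEnergy s K z ≤ shiftEnergy s K (z + t • τ) + shiftEnergy s K (z - t • τ) +
        ENNReal.ofReal (C * t ^ 3) := by
  obtain ⟨p, τ, D, hD, hp, hpD, hzτ, hstrip⟩ := exists_strip (by simp) hK hKc hKi hz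
  obtain ⟨e, he⟩ := exists_obliqueCoords (by simp) hzτ
  obtain ⟨κ, hκ⟩ := exists_volume_eq_mul_volume_preimage e
  have hKm := hKc.measurableSet
  set S : Set (ℝ × ℝ) := {c | p + (c.1 • z + c.2 • τ) ∈ K}
  have hScoords : ∀ c, c ∈ S ↔ p + (c.1 • z + c.2 • τ) ∈ K := fun c => Iff.rfl
  have hSconv : Convex ℝ S := by
    intro c hc d hd a b ha hb hab
    rw [hScoords] at *
    have := hK hc hd ha hb hab
    convert this using 1
    obtain rfl : b = 1 - a := by linarith
    simp only [Prod.fst_add, Prod.snd_add, Prod.smul_fst, Prod.smul_snd, smul_eq_mul]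
    module
  have hScpt : IsCompact S := by
    have : S = (fun x => e.symm (x - p)) '' K := by
      ext c
      rw [hScoords, ← he]
      refine ⟨fun h => ⟨_, h, by simp⟩, ?_⟩
      rintro ⟨x, hx, rfl⟩
      simpa using hx
    rw [this]
    exact hKc.image (by fun_prop)
  obtain ⟨C, hC, t₀, ht₀, hmain⟩ := exists_plane_overlap_second_difference hSconv hScpt hD
    (by simpa [hScoords] using hp) (by simpa [hScoords] using hpD)
    (fun q hq => hstrip q.1 q.2 hq)
  have hover : ∀ a b : ℝ, volume {x | x ∈ K ∧ x + (a • z + b • τ) ∈ K} =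
      κ * volume {q : ℝ × ℝ | q ∈ S ∧ q + (a, b) ∈ S} := by
    intro a b
    rw [hκ p]
    · congr 2
      ext c
      simp only [mem_ofPred_eq, hScoords, he, Prod.fst_add, Prod.snd_add]
      refine and_congr_right fun _ => ?_
      have : p + (c.1 • z + c.2 • τ) + (a • z + b • τ) =
        p + ((c.1 + a) • z + (c.2 + b) • τ) := by module
      rw [this]
    · exact hKm.inter (hKm.preimage (by fun_prop : Measurable
        fun x : EuclideanSpace ℝ (Fin 2) => x + (a • z + b • τ)))
  have hKf : volume K ≠ ∞ := hKc.measure_ne_top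
  have hpoint : ∀ t ∈ Ioo 0 t₀, ∀ r : ℝ, 0 < r → 2 * shiftLoss K (r • z) ≤
      shiftLoss K (r • (z + t • τ)) + shiftLoss K (r • (z - t • τ)) +
        κ * (Icc (D - C * t) D).indicator (fun _ => ENNReal.ofReal (C * t ^ 2)) r := by
    intro t ht r hr
    have h0 := shiftLoss_add_volume_inter hKm (r • z)
    have h1 := shiftLoss_add_volume_inter hKm (r • (z + t • τ))
    have h2 := shiftLoss_add_volume_inter hKm (r • (z - t • τ))
    have e0 : r • z = r • z + (0 : ℝ) • τ := by module
    have e1 : r • (z + t • τ) = r • z + (r * t) • τ := by module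
    have e2 : r • (z - t • τ) = r • z + (-(r * t)) • τ := by module
    rw [e0, hover] at h0
    rw [e1, hover] at h1
    rw [e2, hover] at h2
    rw [e1, e2]
    nth_rw 1 [e0]
    have hm := hmain t ht r hr
    set err := (Icc (D - C * t) D).indicator (fun _ => ENNReal.ofReal (C * t ^ 2)) r
    set g0 := volume {q : ℝ × ℝ | q ∈ S ∧ q + (r, 0) ∈ S}
    set g1 := volume {q : ℝ × ℝ | q ∈ S ∧ q + (r, r * t) ∈ S}
    set g2 := volume {q : ℝ × ℝ | q ∈ S ∧ q + (r, -(r * t)) ∈ S}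
    have hfin : κ * g1 + κ * g2 ≠ ∞ := by
      refine ENNReal.add_ne_top.2 ⟨ne_top_of_le_ne_top hKf ?_, ne_top_of_le_ne_top hKf ?_⟩
      · rw [← h1]; exact le_add_self
      · rw [← h2]; exact le_add_self
    rw [← ENNReal.add_le_add_iff_right hfin]
    calc _ ≤ 2 * shiftLoss K (r • z + (0 : ℝ) • τ) + κ * (2 * g0 + err) := by
          gcongr; rw [← mul_add]; gcongr
      _ = 2 * (shiftLoss K (r • z + (0 : ℝ) • τ) + κ * g0) + κ * err := by ring
      _ = (shiftLoss K (r • z + (r * t) • τ) + κ * g1) +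
          (shiftLoss K (r • z + (-(r * t)) • τ) + κ * g2) + κ * err := by
          rw [h0, h1, h2, two_mul]
      _ = _ := by ring
  set B : ℝ := s * (D / 2) ^ (-s - 1) with hB
  have hB0 : 0 ≤ B := by positivity
  refine ⟨τ, hzτ, κ * B * C ^ 2, by positivity, min t₀ (D / (2 * (C + 1))),
    lt_min ht₀ (by positivity), fun t ht => ?_⟩
  have ht0 : 0 < t := ht.1
  have htt : t ∈ Ioo 0 t₀ := ⟨ht0, ht.2.trans_le (min_le_left _ _)⟩
  have htC : C * t ≤ D / 2 := by
    have h := ht.2.trans_le (min_le_right _ _)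
    rw [lt_div_iff₀ (by positivity)] at h
    nlinarith
  have hmeasw : Measurable fun r : ℝ => ENNReal.ofReal (s * r ^ (-s - 1)) := by fun_prop
  have hmeas : ∀ v, Measurable fun r : ℝ =>
      ENNReal.ofReal (s * r ^ (-s - 1)) * shiftLoss K (r • v) := fun v =>
    hmeasw.mul (measurable_shiftLoss_smul hKm v)
  have herr : ∫⁻ r in Ioi (0 : ℝ), ENNReal.ofReal (s * r ^ (-s - 1)) *
      (κ * (Icc (D - C * t) D).indicator (fun _ => ENNReal.ofReal (C * t ^ 2)) r) ≤
      ENNReal.ofReal (κ * B * C ^ 2 * t ^ 3) := by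
    calc _ ≤ ∫⁻ r in Ioi (0 : ℝ), (Icc (D - C * t) D).indicator
          (fun _ => ENNReal.ofReal (κ * B * C * t ^ 2)) r := by
          refine lintegral_mono fun r => ?_
          by_cases hr : r ∈ Icc (D - C * t) D
          · rw [indicator_of_mem hr, indicator_of_mem hr, ← ENNReal.ofReal_coe_nnreal,
              ← ENNReal.ofReal_mul (by positivity), ← ENNReal.ofReal_mul' (by positivity)]
            refine ENNReal.ofReal_le_ofReal ?_
            have hr1 : D / 2 ≤ r := by linarith [hr.1]
            have hle : s * r ^ (-s - 1) ≤ B := by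
              rw [hB]
              gcongr s * ?_
              exact Real.rpow_le_rpow_of_nonpos (by positivity) hr1 (by linarith)
            calc _ ≤ B * (κ * (C * t ^ 2)) := by gcongr
              _ = _ := by ring
          · rw [indicator_of_notMem hr, indicator_of_notMem hr, mul_zero, mul_zero]
      _ ≤ ∫⁻ r, (Icc (D - C * t) D).indicator
          (fun _ => ENNReal.ofReal (κ * B * C * t ^ 2)) r := setLIntegral_le_lintegral _ _
      _ = ENNReal.ofReal (κ * B * C * t ^ 2) * ENNReal.ofReal (C * t) := by
          rw [lintegral_indicator measurableSet_Icc, setLIntegral_const, Real.volume_Icc,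
            sub_sub_cancel]
      _ = _ := by
          rw [← ENNReal.ofReal_mul (by positivity)]; congr 1; ring
  refine le_trans ?_ (add_le_add_right herr _)
  rw [shiftEnergy, shiftEnergy, shiftEnergy, ← lintegral_const_mul _ (hmeas z),
    ← lintegral_add_left (hmeas _), ← lintegral_add_left ((hmeas _).fun_add (hmeas _))]
  refine setLIntegral_mono' measurableSet_Ioi fun r hr => ?_
  rw [← mul_add, ← mul_add, mul_left_comm]
  exact mul_le_mul_right (hpoint t htt r hr) _

/-! ### A second difference criterion for convexity of homogeneous functions -/

/-- The second order gain behind `convexOn_of_second_difference`: the function `αβ / (α + β)` is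
strictly concave transversally to the rays. -/
lemma mul_div_add_second_difference {α β α' β' t : ℝ} (h1 : α + β = 1)
    (hp : 0 < 1 + t * (α' + β')) (hm : 0 < 1 - t * (α' + β')) :
    (α + t * α') * (β + t * β') / (1 + t * (α' + β')) +
      (α - t * α') * (β - t * β') / (1 - t * (α' + β')) ≤
    2 * (α * β) - 2 * t ^ 2 * (α * β' - β * α') ^ 2 := by
  obtain rfl : β = 1 - α := by linarith
  obtain ⟨k, hk⟩ : ∃ k, α' + β' = k := ⟨_, rfl⟩
  rw [hk] at hp hm ⊢
  obtain rfl : β' = k - α' := by linarith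
  have e1 : (α + t * α') * (1 - α + t * (k - α')) / (1 + t * k) =
      α * (1 - α) + t * (α' * (1 - 2 * α) + α ^ 2 * k) -
        t ^ 2 * (α * (k - α') - (1 - α) * α') ^ 2 / (1 + t * k) := by
    field_simp; ring
  have e2 : (α - t * α') * (1 - α - t * (k - α')) / (1 - t * k) =
      α * (1 - α) - t * (α' * (1 - 2 * α) + α ^ 2 * k) -
        t ^ 2 * (α * (k - α') - (1 - α) * α') ^ 2 / (1 - t * k) := by
    field_simp; ring
  rw [e1, e2]
  set X := t ^ 2 * (α * (k - α') - (1 - α) * α') ^ 2 with hX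
  have hX0 : 0 ≤ X := by positivity
  have h2 : 2 * X ≤ X / (1 + t * k) + X / (1 - t * k) := by
    have : X / (1 + t * k) + X / (1 - t * k) = 2 * X / ((1 + t * k) * (1 - t * k)) := by
      field_simp; ring
    rw [this, le_div_iff₀ (by positivity)]
    nlinarith [sq_nonneg (t * k), mul_nonneg hX0 (sq_nonneg (t * k))]
  linarith

/-- A continuous positively homogeneous function on a plane is convex on the cone spanned by `v` and
`w` as soon as at each point its symmetric second differences in one transversal direction are
bounded below by `-o(t ^ 2)`. -/
lemma convex_ineq_of_second_difference {E : Type*} [NormedAddCommGroup E] [NormedSpace ℝ E]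
    {F : E → ℝ} (hFc : Continuous F) (hFh : ∀ (c : ℝ) (x : E), 0 < c → F (c • x) = c * F x)
    (hF2 : ∀ z : E, z ≠ 0 → ∃ τ : E, LinearIndependent ℝ ![z, τ] ∧ ∀ ε : ℝ, 0 < ε →
      ∀ᶠ t in nhdsWithin (0 : ℝ) (Ioi 0), 2 * F z - ε * t ^ 2 ≤ F (z + t • τ) + F (z - t • τ))
    {v w : E} (hvw : LinearIndependent ℝ ![v, w]) (hspan : Submodule.span ℝ {v, w} = ⊤)
    {a b : ℝ} (ha : 0 ≤ a) (hb : 0 ≤ b) (hab : a + b = 1) :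
    F (a • v + b • w) ≤ a * F v + b * F w := by
  by_contra! hlt
  set δ := F (a • v + b • w) - (a * F v + b * F w) with hδ
  have hδ0 : 0 < δ := by simp only [hδ]; linarith
  have hcoord : ∀ x : E, ∃ α β : ℝ, x = α • v + β • w := by
    intro x
    have : x ∈ Submodule.span ℝ {v, w} := hspan ▸ Submodule.mem_top
    obtain ⟨α, β, h⟩ := Submodule.mem_span_pair.1 this
    exact ⟨α, β, h.symm⟩
  -- The deviation from the chord, less a strictly concave function of the position.
  let H : ℝ → ℝ := fun β => F ((1 - β) • v + β • w) - ((1 - β) * F v + β * F w) -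
    δ * ((1 - β) * β)
  have hHc : Continuous H := by fun_prop
  obtain ⟨β, hβ, hmax⟩ := isCompact_Icc.exists_isMaxOn (nonempty_Icc.2 zero_le_one)
    (hHc.continuousOn (s := Icc (0 : ℝ) 1))
  obtain rfl : a = 1 - b := by linarith
  have hHb : 0 < H b := by
    have : (1 - b) * b ≤ 1 / 4 := by nlinarith [sq_nonneg (b - 1 / 2)]
    simp only [H]
    nlinarith
  have hHβ : 0 < H β := hHb.trans_le (hmax ⟨hb, by linarith⟩)
  have hβ0 : 0 < β := by
    rcases hβ.1.eq_or_lt with h | h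
    · subst h; simp [H] at hHβ
    · exact h
  have hβ1 : β < 1 := by
    rcases hβ.2.eq_or_lt with h | h
    · subst h; simp [H] at hHβ
    · exact h
  set α := 1 - β with hα
  have hα0 : 0 < α := by simp only [hα]; linarith
  have hαβ : α + β = 1 := by simp only [hα]; ring
  have hz0 : α • v + β • w ≠ 0 := by
    intro h0
    have := (LinearIndependent.pair_iff.1 hvw) α β h0
    exact hα0.ne' this.1
  obtain ⟨τ, hτ, hsec⟩ := hF2 _ hz0
  obtain ⟨α', β', rfl⟩ := hcoord τ
  have hdet : α * β' - β * α' ≠ 0 := by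
    intro h0
    have := (LinearIndependent.pair_iff.1 hτ) α' (-α) (by
      have h3 : α * β' = β * α' := by linarith
      have : α' • (α • v + β • w) + -α • (α' • v + β' • w) =
        (β * α' - α * β') • w := by module
      rw [this, h3, sub_self, zero_smul])
    exact hα0.ne' (neg_eq_zero.1 this.2)
  set κ := (α * β' - β * α') ^ 2 with hκ
  have hκ0 : 0 < κ := by positivity
  -- Upper bound for `F` on the cone, from the maximality of `H β`.
  have hup : ∀ x y : ℝ, 0 < x → 0 < y → F (x • v + y • w) ≤
      (x + y) * H β + (x * F v + y * F w) + δ * (x * y / (x + y)) := by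
    intro x y hx hy
    have hxy : 0 < x + y := by positivity
    have h1 : y / (x + y) ∈ Icc (0 : ℝ) 1 :=
      ⟨by positivity, by rw [div_le_one hxy]; linarith⟩
    have h2 : H (y / (x + y)) ≤ H β := hmax h1
    have h3 : 1 - y / (x + y) = x / (x + y) := by field_simp; ring
    have h4 : F (x • v + y • w) = (x + y) * F ((x / (x + y)) • v + (y / (x + y)) • w) := by
      rw [← hFh _ _ hxy, smul_add, smul_smul, smul_smul, mul_div_cancel₀ _ hxy.ne',
        mul_div_cancel₀ _ hxy.ne']
    have h5 : H (y / (x + y)) = F ((x / (x + y)) • v + (y / (x + y)) • w) -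
        (x / (x + y) * F v + y / (x + y) * F w) - δ * (x / (x + y) * (y / (x + y))) := by
      simp only [H, h3]
    have h6 : F ((x / (x + y)) • v + (y / (x + y)) • w) ≤ H β +
        (x / (x + y) * F v + y / (x + y) * F w) + δ * (x / (x + y) * (y / (x + y))) := by linarith
    rw [h4]
    calc _ ≤ (x + y) * (H β +
        (x / (x + y) * F v + y / (x + y) * F w) + δ * (x / (x + y) * (y / (x + y)))) := by gcongr
      _ = _ := by field_simp
  have hHdef : H β = F (α • v + β • w) - (α * F v + β * F w) - δ * (α * β) := rfl
  have ev1 : ∀ c d : ℝ, 0 < c → ∀ᶠ t in nhdsWithin (0 : ℝ) (Ioi 0), 0 < c + t * d := by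
    intro c d hc
    have : Filter.Tendsto (fun t : ℝ => c + t * d) (nhdsWithin 0 (Ioi 0)) (nhds (c + 0 * d)) :=
      ((by fun_prop : Continuous fun t : ℝ => c + t * d).tendsto 0).mono_left nhdsWithin_le_nhds
    exact this.eventually (lt_mem_nhds (by linarith))
  have hev := (hsec (δ * κ) (by positivity)).and ((ev1 α α' hα0).and ((ev1 α (-α') hα0).and
    ((ev1 β β' hβ0).and ((ev1 β (-β') hβ0).and self_mem_nhdsWithin))))
  obtain ⟨t, ht, ha1, ha2, hb1, hb2, ht0⟩ := hev.exists
  have ht0 : 0 < t := ht0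
  have e1 : α • v + β • w + t • (α' • v + β' • w) = (α + t * α') • v + (β + t * β') • w := by
    module
  have e2 : α • v + β • w - t • (α' • v + β' • w) = (α + t * -α') • v + (β + t * -β') • w := by
    module
  have u1 := hup _ _ ha1 hb1
  have u2 := hup _ _ ha2 hb2
  rw [e1, e2] at ht
  have s1 : α + t * α' + (β + t * β') = 1 + t * (α' + β') := by linear_combination hαβ
  have s2 : α + t * -α' + (β + t * -β') = 1 - t * (α' + β') := by linear_combination hαβ
  have hq := mul_div_add_second_difference (t := t) (α' := α') (β' := β') hαβ
    (by rw [← s1]; positivity) (by rw [← s2]; positivity)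
  rw [s1] at u1
  rw [s2] at u2
  have s3 : (α + t * -α') * (β + t * -β') = (α - t * α') * (β - t * β') := by ring
  rw [s3] at u2
  have hq2 := mul_le_mul_of_nonneg_left hq hδ0.le
  have : 0 < δ * κ * t ^ 2 := by positivity
  rw [← hκ] at hq2
  nlinarith

/-- A continuous nonnegative positively homogeneous function on a plane is convex as soon as at
each nonzero point its symmetric second differences in one transversal direction are bounded below
by `-o(t ^ 2)`. -/
theorem convexOn_of_second_difference {E : Type*} [NormedAddCommGroup E] [NormedSpace ℝ E]
    (hE : Module.finrank ℝ E = 2)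
    {F : E → ℝ} (hFc : Continuous F) (hF0 : ∀ x, 0 ≤ F x) (hFz : F 0 = 0)
    (hFh : ∀ (c : ℝ) (x : E), 0 < c → F (c • x) = c * F x)
    (hF2 : ∀ z : E, z ≠ 0 → ∃ τ : E, LinearIndependent ℝ ![z, τ] ∧ ∀ ε : ℝ, 0 < ε →
      ∀ᶠ t in nhdsWithin (0 : ℝ) (Ioi 0), 2 * F z - ε * t ^ 2 ≤ F (z + t • τ) + F (z - t • τ)) :
    ConvexOn ℝ univ F := by
  have hFh' : ∀ (c : ℝ) (x : E), 0 ≤ c → F (c • x) = c * F x := by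
    intro c x hc
    rcases hc.eq_or_lt with rfl | hc
    · simp [hFz]
    · exact hFh c x hc
  refine ⟨convex_univ, fun v _ w _ a b ha hb hab => ?_⟩
  simp only [smul_eq_mul]
  by_cases hv : v = 0
  · subst hv; simp [hFz, hFh' b w hb]
  by_cases hvw : LinearIndependent ℝ ![v, w]
  · refine convex_ineq_of_second_difference hFc hFh hF2 hvw ?_ ha hb hab
    have : FiniteDimensional ℝ E := .of_finrank_eq_succ hE
    have := hvw.span_eq_top_of_card_eq_finrank' (by simp [hE])
    simpa [Set.pair_comm] using this
  · rw [LinearIndependent.pair_iff' hv] at hvw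
    push Not at hvw
    obtain ⟨c, rfl⟩ := hvw
    -- On a line, `F` is the maximum of two linear functions.
    have key : ∀ d : ℝ, F (d • v) = max d 0 * F v + max (-d) 0 * F (-v) := by
      intro d
      rcases le_total 0 d with hd | hd
      · rw [hFh' d v hd, max_eq_left hd, max_eq_right (by linarith)]; ring
      · have : d • v = (-d) • (-v) := by simp
        rw [this, hFh' (-d) _ (by linarith), max_eq_right hd, max_eq_left (by linarith)]; ring
    have e : a • v + b • c • v = (a + b * c) • v := by module
    have k1 := key (a + b * c)
    have k2 := key c
    rw [e, k1, k2]
    have h1 : max (a + b * c) 0 ≤ a + b * max c 0 := by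
      refine max_le ?_ ?_
      · gcongr; exact le_max_left _ _
      · positivity
    have h2 : max (-(a + b * c)) 0 ≤ b * max (-c) 0 := by
      refine max_le ?_ (by positivity)
      nlinarith [le_max_left (-c) 0]
    nlinarith [mul_le_mul_of_nonneg_right h1 (hF0 v), mul_le_mul_of_nonneg_right h2 (hF0 (-v))]

/-! ### Convexity of the radial mean body -/

/-- The tangent inequality for the convex function `x ↦ x ^ q`. -/
lemma rpow_add_mul_sub_le_rpow {q x y : ℝ} (hq : 1 ≤ q) (hx : 0 ≤ x) (hy : 0 ≤ y) :
    y ^ q + q * y ^ (q - 1) * (x - y) ≤ x ^ q := by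
  rcases hy.eq_or_lt with rfl | hy
  · rcases hq.eq_or_lt with rfl | hq
    · simp
    · rw [Real.zero_rpow (by linarith), Real.zero_rpow (by linarith)]
      simpa using Real.rpow_nonneg hx q
  · have h := one_add_mul_self_le_rpow_one_add (s := (x - y) / y)
      (by rw [le_div_iff₀ hy]; linarith) hq
    have e : 1 + (x - y) / y = x / y := by field_simp; ring
    rw [e, Real.div_rpow hx hy.le, le_div_iff₀ (Real.rpow_pos_of_pos hy q)] at h
    refine le_trans (le_of_eq ?_) h
    rw [Real.rpow_sub_one hy.ne']
    field_simp

theorem theorem1p1 (K : ConvexBody (EuclideanSpace ℝ (Fin 2)))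
    (hK : (interior (K : Set (EuclideanSpace ℝ (Fin 2)))).Nonempty)
    (p : ℝ) (hp : p ∈ Set.Ioo (-1 : ℝ) 0) :
    Convex ℝ (radialMeanBody p (K : Set (EuclideanSpace ℝ (Fin 2)))) ∧
    (∀ v : EuclideanSpace ℝ (Fin 2),
      radialMeanNorm p (K : Set (EuclideanSpace ℝ (Fin 2))) v < ∞) ∧
    ConvexOn ℝ Set.univ (fun v : EuclideanSpace ℝ (Fin 2) =>
      (radialMeanNorm p (K : Set (EuclideanSpace ℝ (Fin 2))) v).toReal) := by
  obtain ⟨s, rfl⟩ : ∃ s, p = -s := ⟨-p, by ring⟩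
  have hs : s ∈ Ioo (0 : ℝ) 1 := ⟨by linarith [hp.2], by linarith [hp.1]⟩
  have hs0 : 0 < s := hs.1
  set S := (K : Set (EuclideanSpace ℝ (Fin 2)))
  have hSconv : Convex ℝ S := K.convex
  have hSc : IsCompact S := K.isCompact
  have hSm : MeasurableSet S := hSc.measurableSet
  have hSf : volume S ≠ ∞ := hSc.measure_ne_top
  have hS0 : volume S ≠ 0 := (Measure.measure_pos_of_nonempty_interior volume hK).ne'
  have hVinv : (volume S)⁻¹ ≠ ∞ := ENNReal.inv_ne_top.2 hS0
  have hq : 1 ≤ 1 / s := by rw [le_div_iff₀ hs0]; linarith [hs.2]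
  have hq0 : 0 ≤ 1 / s := by positivity
  have hnorm : ∀ v, radialMeanNorm (-s) S v = ((volume S)⁻¹ * shiftEnergy s S v) ^ (1 / s) := by
    intro v
    rw [radialMeanNorm, setLIntegral_radialFun_rpow hSconv hSm hs0, neg_div_neg_eq]
  obtain ⟨B, hB⟩ := exists_shiftEnergy_le_rpow_norm hSconv hSm hSf hK hs
  have hGfin : ∀ v, shiftEnergy s S v ≠ ∞ := fun v =>
    ne_top_of_le_ne_top ENNReal.ofReal_ne_top (hB v)
  have hfin : ∀ v, radialMeanNorm (-s) S v ≠ ∞ := by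
    intro v
    rw [hnorm]
    exact ENNReal.rpow_ne_top_of_nonneg hq0 (ENNReal.mul_ne_top hVinv (hGfin v))
  set W := ((volume S)⁻¹).toReal with hW
  have hW0 : 0 ≤ W := ENNReal.toReal_nonneg
  set G : EuclideanSpace ℝ (Fin 2) → ℝ := fun v => W * (shiftEnergy s S v).toReal with hG
  have hG0 : ∀ v, 0 ≤ G v := fun v => mul_nonneg hW0 ENNReal.toReal_nonneg
  set F : EuclideanSpace ℝ (Fin 2) → ℝ := fun v => (radialMeanNorm (-s) S v).toReal with hF
  have hFG : ∀ v, F v = G v ^ (1 / s) := by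
    intro v
    simp only [hF, hG, hnorm, hW, ← ENNReal.toReal_rpow, ENNReal.toReal_mul]
  have hGc : Continuous G :=
    continuous_const.mul (continuous_shiftEnergy_toReal hSconv hSm hSf hK hs)
  have hFc : Continuous F := by
    rw [funext hFG]
    exact hGc.rpow_const fun _ => Or.inr hq0
  have hconv : ConvexOn ℝ univ F := by
    refine convexOn_of_second_difference (by simp) hFc (fun _ => ENNReal.toReal_nonneg) ?_ ?_ ?_
    · rw [hFG]
      simp only [hG, shiftEnergy_zero, ENNReal.toReal_zero, mul_zero]
      exact Real.zero_rpow (by positivity)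
    · intro c x hc
      have : G (c • x) = c ^ s * G x := by
        simp only [hG, shiftEnergy_smul hSconv hSm hs0 hc, ENNReal.toReal_mul]
        rw [ENNReal.toReal_ofReal (by positivity)]; ring
      rw [hFG, hFG, this, Real.mul_rpow (by positivity) (hG0 x), ← Real.rpow_mul hc.le,
        mul_one_div_cancel hs0.ne', Real.rpow_one]
    · intro z hz
      obtain ⟨τ, hzτ, C, hC, t₀, ht₀, hmain⟩ :=
        exists_shiftEnergy_second_difference hSconv hSc hK hs0 hz
      refine ⟨τ, hzτ, fun ε hε => ?_⟩
      have hreal : ∀ t ∈ Ioo 0 t₀, 2 * G z ≤ G (z + t • τ) + G (z - t • τ) + W * C * t ^ 3 := by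
        intro t ht
        have ht0 : 0 < t := ht.1
        have h := ENNReal.toReal_mono (ENNReal.add_ne_top.2
          ⟨ENNReal.add_ne_top.2 ⟨hGfin _, hGfin _⟩, ENNReal.ofReal_ne_top⟩) (hmain t ht)
        rw [ENNReal.toReal_add (ENNReal.add_ne_top.2 ⟨hGfin _, hGfin _⟩) ENNReal.ofReal_ne_top,
          ENNReal.toReal_add (hGfin _) (hGfin _), ENNReal.toReal_ofReal (by positivity),
          ENNReal.toReal_mul, ENNReal.toReal_ofNat] at h
        have h' := mul_le_mul_of_nonneg_left h hW0
        simp only [hG]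
        linarith
      set M := 1 / s * G z ^ (1 / s - 1) with hM
      have hM0 : 0 ≤ M := mul_nonneg hq0 (Real.rpow_nonneg (hG0 z) _)
      have hδ : 0 < ε / (M * W * C + 1) := by positivity
      filter_upwards [Ioo_mem_nhdsGT (lt_min ht₀ hδ)] with t ht
      have ht0 : 0 < t := ht.1
      have h1 := hreal t ⟨ht0, ht.2.trans_le (min_le_left _ _)⟩
      have h2 := ht.2.trans_le (min_le_right _ _)
      rw [lt_div_iff₀ (by positivity)] at h2
      have k1 := rpow_add_mul_sub_le_rpow hq (hG0 (z + t • τ)) (hG0 z)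
      have k2 := rpow_add_mul_sub_le_rpow hq (hG0 (z - t • τ)) (hG0 z)
      rw [← hFG, ← hFG, ← hM] at k1 k2
      have h3 := mul_le_mul_of_nonneg_left h1 hM0
      have h4 : M * W * C * t ≤ ε := by nlinarith
      have h5 := mul_le_mul_of_nonneg_right h4 (sq_nonneg t)
      have e5 : M * W * C * t * t ^ 2 = M * (W * C * t ^ 3) := by ring
      rw [e5] at h5
      linarith
  refine ⟨?_, fun v => (hfin v).lt_top, hconv⟩
  have hbody : radialMeanBody (-s) S = {v ∈ univ | F v ≤ 1} := by
    ext v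
    simp only [radialMeanBody, mem_ofPred_eq, mem_univ, true_and, hF]
    rw [← ENNReal.toReal_one, ENNReal.toReal_le_toReal (hfin v) ENNReal.one_ne_top]
  rw [hbody]
  exact hconv.convex_le 1
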